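/- Let $G$ be a finite connected graph (loops and parallel edges are allowed), and consider the usual random walk on $G$: at each step it chooses, uniformly at random, an edge incident with the current vertex and moves to the other end of that edge (it stays put if the edge is a loop; on a single vertex without edges it stays there forever). Let $\pi$ be the stationary distribution of this walk. For vertices $i,j$ let $H(i,j)$ be the expected number of steps the walk started at $i$ takes until it reaches $j$, let $\kappa(i,j)=H(i,j)+H(j,i)$ be the commute time, and for a set $S\subseteq V(G)$ with $|S|\ge 2$ let $\kappa_S=\min_{i,j\in S,\ i\ne j}\kappa(i,j)$, with $\kappa_S=0$ if $|S|<2$. Put \[ M=\max_{S\subseteq V(G),\ S\neq\emptyset}\kappa_S\ln|S| . \] Let $C(i)$ be the expected number of steps the walk started at $i$ takes until it has visited all vertices of $G$, and let $C(\pi)=\sum_i \pi_i C(i)$. Then \[ C(\pi)\ \ge\ \tfrac12 M . \] -/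

import Mathlib

open MeasureTheory ProbabilityTheory
open scoped ENNReal Graph

namespace CoverTime

universe u v

/-- Vertices carry the discrete σ-algebra. -/
instance vertexMeasurableSpace {α : Type u} {β : Type v} (G : Graph α β) :
    MeasurableSpace V(G) := ⊤

instance vertexDiscreteMeasurableSpace {α : Type u} {β : Type v} (G : Graph α β) :
    DiscreteMeasurableSpace V(G) := ⟨fun _ => trivial⟩

/-- A multigraph (loops and parallel edges allowed) is connected if it has a vertex and
any two of its vertices are joined by a finite chain of adjacent vertices. -/
def Connected {α : Type u} {β : Type v} (G : Graph α β) : Prop :=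
  V(G).Nonempty ∧ ∀ x ∈ V(G), ∀ y ∈ V(G), Relation.ReflTransGen G.Adj x y

theorem incidenceSet_finite {α : Type u} {β : Type v} (G : Graph α β) [Finite E(G)] (x : α) :
    (G.incidenceSet x).Finite :=
  (Set.toFinite E(G)).subset fun _ he => he.edge_mem

open scoped Classical in
/-- One step of the usual random walk: pick a uniformly random edge incident with `x` and move to
its other end (which is `x` itself if the edge is a loop). At a vertex without edges the walk
stays put. -/
noncomputable def step {α : Type u} {β : Type v} (G : Graph α β) [Finite E(G)] (x : V(G)) :
    PMF V(G) :=
  if h : (G.incidenceSet (x : α)).Nonempty then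
    (PMF.uniformOfFinset (incidenceSet_finite G (x : α)).toFinset (by simpa using h)).map
      (fun e => if he : G.Inc e (x : α) then ⟨he.other, he.isLink_other.right_mem⟩ else x)
  else PMF.pure x

/-- The one-step transition kernel of the random walk. -/
noncomputable def stepKernel {α : Type u} {β : Type v} (G : Graph α β) [Finite E(G)] :
    Kernel V(G) V(G) where
  toFun x := (step G x).toMeasure
  measurable' := Measurable.of_discrete

instance stepKernel_isMarkovKernel {α : Type u} {β : Type v} (G : Graph α β) [Finite E(G)] :
    IsMarkovKernel (stepKernel G) :=
  ⟨fun x => PMF.toMeasure.isProbabilityMeasure (step G x)⟩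

/-- The law, on the space of trajectories `ℕ → V(G)`, of the random walk starting from `i`: given
the trajectory up to time `n`, the next vertex is distributed as one step from the `n`-th one. -/
noncomputable def walkLaw {α : Type u} {β : Type v} (G : Graph α β) [Finite E(G)] (i : V(G)) :
    Measure (ℕ → V(G)) :=
  Kernel.trajMeasure (X := fun _ => V(G)) (Measure.dirac i)
    (fun n => (stepKernel G).comap (fun h => h ⟨n, by simp⟩) (by fun_prop))

/-- The first time the trajectory `w` visits `j` (`∞` if it never does). -/
noncomputable def hitTime {V : Type u} (j : V) (w : ℕ → V) : ℝ≥0∞ :=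
  ⨅ (n : ℕ) (_ : w n = j), (n : ℝ≥0∞)

/-- The first time by which the trajectory `w` has visited all vertices (`∞` if there is none). -/
noncomputable def covTime {V : Type u} (w : ℕ → V) : ℝ≥0∞ :=
  ⨅ (n : ℕ) (_ : ∀ v : V, ∃ k ≤ n, w k = v), (n : ℝ≥0∞)

/-- The hitting time `H(i,j)`: expected number of steps from `i` until `j` is reached. -/
noncomputable def H {α : Type u} {β : Type v} (G : Graph α β) [Finite E(G)] (i j : V(G)) : ℝ≥0∞ :=
  ∫⁻ w, hitTime j w ∂(walkLaw G i)

/-- The cover time `C(i)` from `i`: expected number of steps from `i` until all vertices of `G`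
are visited. -/
noncomputable def C {α : Type u} {β : Type v} (G : Graph α β) [Finite E(G)] (i : V(G)) : ℝ≥0∞ :=
  ∫⁻ w, covTime w ∂(walkLaw G i)

/-- The cover time `C(π) = ∑ i, π i * C(i)` from a random start. -/
noncomputable def Cstart {α : Type u} {β : Type v} (G : Graph α β) [Finite E(G)]
    (π : PMF V(G)) : ℝ≥0∞ :=
  ∑' i, π i * C G i

/-- `π` is a stationary distribution of the random walk. -/
def IsStationary {α : Type u} {β : Type v} (G : Graph α β) [Finite E(G)] (π : PMF V(G)) : Prop :=
  π.bind (step G) = π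

/-- The commute time `κ(i,j) = H(i,j) + H(j,i)`. -/
noncomputable def commute {α : Type u} {β : Type v} (G : Graph α β) [Finite E(G)]
    (i j : V(G)) : ℝ≥0∞ :=
  H G i j + H G j i

/-- `κ_S`, the minimum of `κ(i,j)` over distinct `i, j ∈ S`, and `0` if `S` has fewer than two
elements. -/
noncomputable def commuteMin {α : Type u} {β : Type v} (G : Graph α β) [Finite E(G)]
    (S : Finset V(G)) : ℝ≥0∞ :=
  if 2 ≤ S.card then ⨅ (i ∈ S) (j ∈ S) (_ : i ≠ j), commute G i j else 0

/-- `M = max_S κ_S ln |S|`, over all sets `S` of vertices. -/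
noncomputable def M {α : Type u} {β : Type v} (G : Graph α β) [Finite E(G)] : ℝ≥0∞ :=
  ⨆ S : Finset V(G), commuteMin G S * ENNReal.ofReal (Real.log S.card)

end CoverTime

/-!
Matthews' lower bound compares the time `u A x` to visit all of `A` from `x` with a harmonic number
times the smallest hitting time within `A`. Here hitting times may be very asymmetric and only
commute times are bounded below. Two facts about the reversible walk repair this.

* With `h j = ∑ x, π x * H x j` one has `H i j - H j i = h j - h i` (`IsVisitTime.hit_sub_hit`), so
  `H i j` is half the commute time plus a difference of potentials. In the Matthews sum these
  differences telescope, which leads to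
  `u A x ≥ (mean of H x j over A) + κ / 2 * (harmonic n - 1) + (min of h - mean of h) / 2`
  with `n = |A|` (`IsVisitTime.matthews_bound`). Once this bound is guessed, no random ordering of
  `A` is needed: off `A` both sides satisfy the same first-step equation, and on `A` the bound
  follows from the one for a smaller set, so that the minimum principle
  (`IsIrreducibleChain.nonneg_of_superharmonic_off`) proves it by induction on `A`.
* Averaging over `π` turns the mean of `H x j` into the mean of `h`, and it remains to see that the
  potentials make up for the difference between `harmonic n - 1` and `log n`. This holds because
  `h i + h j` is at least half the commute time of `i` and `j` (`IsVisitTime.half_commute_le`),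
  which yields `(mean of h) + (min of h) ≥ (1 / 2 - 1 / (2 * n)) * κ`, and because
  `harmonic n ≥ log n + 1 / 2 + 1 / (2 * n)` (`log_add_le_harmonic`).

These arguments use only the first-step equations `IsVisitTime` of the expected visiting times, which
follow from the Markov property at time one (`walkLaw_eq_sum`), and detailed balance, which holds
because the density of a stationary distribution with respect to the degree is harmonic, hence
constant (`IsStationary.pos_and_reversible`). Expected visiting times are a priori in `ℝ≥0∞`; if the
cover time from some vertex is infinite then so is the one from `π`, since `π` is positive.
-/

namespace CoverTime

/-! ### Finite irreducible chains and the minimum principle -/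

/-- `p` is the transition matrix of an irreducible Markov chain on the finite state space `V`. -/
structure IsIrreducibleChain {V : Type*} [Fintype V] (p : V → V → ℝ) : Prop where
  nonneg : ∀ x y, 0 ≤ p x y
  sum_eq_one : ∀ x, ∑ y, p x y = 1
  irreducible : ∀ x y, Relation.ReflTransGen (fun a b => 0 < p a b) x y

section Chain

variable {V : Type*} [Fintype V] {p : V → V → ℝ}

/-- Minimum principle: the set of minimizers of `g` is closed under transitions as long as it does
not meet `B`, so by irreducibility the minimum is attained on `B`. -/
theorem IsIrreducibleChain.nonneg_of_superharmonic_off (hp : IsIrreducibleChain p) {g : V → ℝ}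
    {B : Set V} (hB : B.Nonempty) (hgB : ∀ x ∈ B, 0 ≤ g x)
    (hg : ∀ x ∉ B, ∑ y, p x y * g y ≤ g x) (x : V) : 0 ≤ g x := by
  obtain ⟨b, hb⟩ := hB
  have : Nonempty V := ⟨b⟩
  obtain ⟨x₀, hx₀⟩ := Finite.exists_min g
  by_contra! hx
  have hneg : g x₀ < 0 := (hx₀ x).trans_lt hx
  have key : ∀ y, Relation.ReflTransGen (fun a b => 0 < p a b) x₀ y → g y = g x₀ := by
    intro y hy
    induction hy with
    | refl => rfl
    | @tail a c _ hac ih =>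
      have haB : a ∉ B := fun h => by linarith [hgB a h]
      have hsum : ∑ y, p a y * (g y - g x₀) ≤ 0 := by
        have h1 := hg a haB
        simp only [mul_sub, Finset.sum_sub_distrib, ← Finset.sum_mul, hp.sum_eq_one]
        linarith
      have hterm : ∀ y ∈ Finset.univ, 0 ≤ p a y * (g y - g x₀) := fun y _ =>
        mul_nonneg (hp.nonneg a y) (sub_nonneg.2 (hx₀ y))
      have hle : p a c * (g c - g x₀) ≤ 0 :=
        (Finset.single_le_sum hterm (Finset.mem_univ c)).trans hsum
      have := nonpos_of_mul_nonpos_right hle hac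
      linarith [hx₀ c]
  linarith [hgB b hb, key b (hp.irreducible x₀ b)]

theorem IsIrreducibleChain.eq_of_harmonic (hp : IsIrreducibleChain p) {g : V → ℝ}
    (hg : ∀ x, ∑ y, p x y * g y = g x) (x y : V) : g x = g y := by
  have key : ∀ x y, g x ≤ g y := by
    intro x y
    refine sub_nonneg.1 (hp.nonneg_of_superharmonic_off (g := fun z => g z - g x) (B := {x})
      ⟨x, rfl⟩ (by simp) (fun z _ => ?_) y)
    simp only [mul_sub, Finset.sum_sub_distrib, ← Finset.sum_mul, hp.sum_eq_one, hg, one_mul,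
      le_refl]
  exact le_antisymm (key x y) (key y x)

/-! ### Expected visiting times: first-step equations and their consequences -/

/-- The first-step equations satisfied by `u A x`, the expected time in which the chain started at
`x` has visited all states of `A`. The hitting time from `x` to `j` is `u {j} x`. -/
structure IsVisitTime [DecidableEq V] (p : V → V → ℝ) (u : Finset V → V → ℝ) : Prop where
  empty : ∀ x, u ∅ x = 0
  step : ∀ A x, A.Nonempty → x ∉ A → u A x = 1 + ∑ y, p x y * u A y
  erase : ∀ A x, x ∈ A → u A x = u (A.erase x) x

variable [DecidableEq V] {u : Finset V → V → ℝ} {π : V → ℝ}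

theorem IsVisitTime.self (hu : IsVisitTime p u) (x : V) : u {x} x = 0 := by
  simpa [hu.empty] using hu.erase {x} x (by simp)

theorem IsVisitTime.hit_step (hu : IsVisitTime p u) {x j : V} (h : x ≠ j) :
    u {j} x = 1 + ∑ y, p x y * u {j} y :=
  hu.step {j} x (by simp) (by simpa using h)

theorem IsVisitTime.hit_nonneg (hu : IsVisitTime p u) (hp : IsIrreducibleChain p) (x j : V) :
    0 ≤ u {j} x := by
  refine hp.nonneg_of_superharmonic_off (B := {j}) ⟨j, rfl⟩ ?_ (fun z hz => ?_) x
  · rintro z rfl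
    exact (hu.self z).ge
  · linarith [hu.hit_step (show z ≠ j from hz)]

/-- The Laplacian of a hitting time `x ↦ u {j} x` is `1 - δ_j / π j`, tested here against an
arbitrary function `f`. Its value at `j` comes from stationarity: the `π`-weighted Laplacian of any
function sums to zero. -/
theorem IsVisitTime.sum_laplacian (hu : IsVisitTime p u) (hπ1 : ∑ x, π x = 1)
    (hstat : ∀ y, ∑ x, π x * p x y = π y) (f : V → ℝ) (j : V) :
    ∑ x, π x * f x * (u {j} x - ∑ y, p x y * u {j} y) = ∑ x, π x * f x - f j := by
  have hzero : ∑ x, π x * (u {j} x - ∑ y, p x y * u {j} y) = 0 := by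
    have h : ∑ x, π x * ∑ y, p x y * u {j} y = ∑ y, π y * u {j} y := by
      simp only [Finset.mul_sum]
      rw [Finset.sum_comm]
      refine Finset.sum_congr rfl fun y _ => ?_
      rw [← hstat y, Finset.sum_mul]
      exact Finset.sum_congr rfl fun x _ => by ring
    simp only [mul_sub, Finset.sum_sub_distrib, h, sub_self]
  set d : V → ℝ := fun x => u {j} x - ∑ y, p x y * u {j} y with hd
  have hoff : ∀ x, x ≠ j → d x = 1 := fun x hx => by
    have := hu.hit_step hx
    simp only [hd]; linarith
  have split : ∀ g : V → ℝ, ∑ x, π x * g x * d x = ∑ x, π x * g x + π j * g j * (d j - 1) := by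
    intro g
    have : ∑ x, π x * g x * (d x - 1) = π j * g j * (d j - 1) :=
      Finset.sum_eq_single j (fun x _ hx => by simp [hoff x hx]) (by simp)
    rw [← this, ← Finset.sum_add_distrib]
    exact Finset.sum_congr rfl fun x _ => by ring
  have hj : π j * (d j - 1) = -1 := by
    have := split fun _ => 1
    simp only [mul_one, hπ1] at this
    linarith
  rw [split f]
  linear_combination f j * hj

/-- For a reversible chain the asymmetry of hitting times is a difference of potentials, the
potential of `j` being the expected hitting time of `j` from a stationary start. The reason is that
the Laplacian is self-adjoint with respect to `π`. -/
theorem IsVisitTime.hit_sub_hit (hu : IsVisitTime p u) (hπ1 : ∑ x, π x = 1)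
    (hstat : ∀ y, ∑ x, π x * p x y = π y) (hrev : ∀ x y, π x * p x y = π y * p y x) (i j : V) :
    ∑ x, π x * u {j} x - ∑ x, π x * u {i} x = u {j} i - u {i} j := by
  have h1 := hu.sum_laplacian hπ1 hstat (u {i}) j
  have h2 := hu.sum_laplacian hπ1 hstat (u {j}) i
  have h3 : ∑ x, π x * u {i} x * ∑ y, p x y * u {j} y =
      ∑ x, π x * u {j} x * ∑ y, p x y * u {i} y := by
    simp only [Finset.mul_sum]
    rw [Finset.sum_comm]
    refine Finset.sum_congr rfl fun y _ => Finset.sum_congr rfl fun x _ => ?_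
    linear_combination u {i} x * u {j} y * hrev x y
  simp only [mul_sub, Finset.sum_sub_distrib, h3] at h1 h2
  have h4 : ∑ x, π x * u {i} x * u {j} x = ∑ x, π x * u {j} x * u {i} x :=
    Finset.sum_congr rfl fun x _ => by ring
  linarith

/-- A stationary start is on average far from one of any two states: the sum of the expected hitting
times of `i` and `j` is at least half their commute time. -/
theorem IsVisitTime.half_commute_le (hu : IsVisitTime p u) (hp : IsIrreducibleChain p)
    (hπ0 : ∀ x, 0 ≤ π x) (hπ1 : ∑ x, π x = 1) (hstat : ∀ y, ∑ x, π x * p x y = π y)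
    (hrev : ∀ x y, π x * p x y = π y * p y x) (i j : V) :
    (u {j} i + u {i} j) / 2 ≤ ∑ x, π x * u {i} x + ∑ x, π x * u {j} x := by
  set a := u {j} i with ha
  set b := u {i} j with hb
  have ha0 : 0 ≤ a := hu.hit_nonneg hp i j
  have hb0 : 0 ≤ b := hu.hit_nonneg hp j i
  have hpot := hu.hit_sub_hit hπ1 hstat hrev i j
  -- This function is `a + b` times the expected hitting time of `{i, j}`; for its sign it is enough
  -- that it is superharmonic off `{i, j}` and vanishes on `{i, j}`.
  have hg : ∀ x, 0 ≤ u {i} x * a + u {j} x * b - a * b := by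
    refine hp.nonneg_of_superharmonic_off (B := {i, j}) ⟨i, by simp⟩ ?_ (fun x hx => ?_)
    · rintro x (rfl | rfl)
      · simp [hu.self, ← ha]
      · simp [hu.self, ← hb, mul_comm]
    · simp only [Set.mem_insert_iff, Set.mem_singleton_iff, not_or] at hx
      have h : ∑ y, p x y * (u {i} y * a + u {j} y * b - a * b) =
          (∑ y, p x y * u {i} y) * a + (∑ y, p x y * u {j} y) * b - a * b := by
        conv_rhs => rw [← one_mul (a * b), ← hp.sum_eq_one x]
        simp only [Finset.sum_mul, ← Finset.sum_add_distrib, ← Finset.sum_sub_distrib]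
        exact Finset.sum_congr rfl fun y _ => by ring
      rw [h, hu.hit_step hx.1, hu.hit_step hx.2]
      nlinarith
  have havg : a * b ≤ (∑ x, π x * u {i} x) * a + (∑ x, π x * u {j} x) * b := by
    have := Finset.sum_nonneg fun x (_ : x ∈ Finset.univ) => mul_nonneg (hπ0 x) (hg x)
    have h : ∑ x, π x * (u {i} x * a + u {j} x * b - a * b) =
        (∑ x, π x * u {i} x) * a + (∑ x, π x * u {j} x) * b - a * b := by
      conv_rhs => rw [← one_mul (a * b), ← hπ1]
      simp only [Finset.sum_mul, ← Finset.sum_add_distrib, ← Finset.sum_sub_distrib]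
      exact Finset.sum_congr rfl fun y _ => by ring
    linarith
  have hi0 : 0 ≤ ∑ x, π x * u {i} x :=
    Finset.sum_nonneg fun x _ => mul_nonneg (hπ0 x) (hu.hit_nonneg hp x i)
  have hj0 : 0 ≤ ∑ x, π x * u {j} x :=
    Finset.sum_nonneg fun x _ => mul_nonneg (hπ0 x) (hu.hit_nonneg hp x j)
  rcases (add_nonneg ha0 hb0).eq_or_lt with h0 | h0
  · linarith
  · refine le_of_mul_le_mul_right ?_ h0
    set s := ∑ x, π x * u {i} x
    set t := ∑ x, π x * u {j} x
    have hst : t = s + a - b := by linarith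
    rw [hst] at havg ⊢
    nlinarith [sq_nonneg (a - b)]

/-! ### A Matthews-type bound from an arbitrary starting state -/

/-- Lower bound on the time to visit all of `A` from any state `x`, in terms of a potential `h` that
governs the asymmetry of hitting times, a lower bound `m` of `h` on `A` and a lower bound `κ` of the
commute times within `A`. Off `A` both sides satisfy the same first-step equation, so by the minimum
principle it is enough to compare them at `x ∈ A`, where the left side is the visiting time of
`A.erase x`; this is the induction. -/
theorem IsVisitTime.matthews_bound (hu : IsVisitTime p u) (hp : IsIrreducibleChain p) {h : V → ℝ}
    (hpot : ∀ i j, h j - h i = u {j} i - u {i} j) {κ m : ℝ} (A : Finset V) (hA : A.Nonempty)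
    (hκ : ∀ i ∈ A, ∀ j ∈ A, i ≠ j → κ ≤ u {j} i + u {i} j) (hm : ∀ i ∈ A, m ≤ h i) (x : V) :
    (∑ j ∈ A, u {j} x) / A.card + κ / 2 * (harmonic A.card - 1) +
      (m - (∑ j ∈ A, h j) / A.card) / 2 ≤ u A x := by
  induction A using Finset.strongInduction generalizing x with
  | H A ih =>
  have hn : (0 : ℝ) < A.card := by exact_mod_cast hA.card_pos
  refine sub_nonneg.1 (hp.nonneg_of_superharmonic_off (B := A) (g := fun x => u A x -
    ((∑ j ∈ A, u {j} x) / A.card + κ / 2 * (harmonic A.card - 1) +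
      (m - (∑ j ∈ A, h j) / A.card) / 2)) hA (fun x hx => ?_) (fun x hx => ?_) x)
  · have hx' : x ∈ A := hx
    rw [sub_nonneg, hu.erase A x hx']
    rcases (A.erase x).eq_empty_or_nonempty with he | hne
    · obtain rfl : A = {x} := by
        rw [← Finset.insert_erase hx', he]; rfl
      have := hm x hx'
      simp [hu.self, hu.empty, harmonic]
      linarith
    · have hB := ih (A.erase x) (Finset.erase_ssubset hx') hne
        (fun i hi j hj => hκ i (Finset.mem_of_mem_erase hi) j (Finset.mem_of_mem_erase hj))
        (fun i hi => hm i (Finset.mem_of_mem_erase hi)) x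
      refine le_trans ?_ hB
      have hcard : A.card = (A.erase x).card + 1 := (Finset.card_erase_add_one hx').symm
      have hk : (0 : ℝ) < (A.erase x).card := by exact_mod_cast hne.card_pos
      have hterm : ∀ j ∈ A.erase x, (κ + (h j - h x)) / 2 ≤ u {j} x := by
        intro j hj
        have := hκ x hx' j (Finset.mem_of_mem_erase hj) (Finset.ne_of_mem_erase hj).symm
        linarith [hpot x j]
      have hsum := Finset.sum_le_sum hterm
      rw [← Finset.sum_div, Finset.sum_add_distrib, Finset.sum_sub_distrib, Finset.sum_const,
        Finset.sum_const, nsmul_eq_mul, nsmul_eq_mul] at hsum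
      rw [← Finset.add_sum_erase A _ hx', ← Finset.add_sum_erase A h hx', hcard, hu.self,
        harmonic_succ]
      set k : ℝ := ((A.erase x).card : ℝ) with hkdef
      set U := ∑ j ∈ A.erase x, u {j} x
      set W := ∑ j ∈ A.erase x, h j
      push_cast
      rw [← hkdef, ← sub_nonneg]
      have : U / k + κ / 2 * (harmonic (A.erase x).card - 1) + (m - W / k) / 2 -
          ((0 + U) / (k + 1) + κ / 2 * (harmonic (A.erase x).card + (k + 1)⁻¹ - 1) +
            (m - (h x + W) / (k + 1)) / 2) =
          (U - (k * κ + (W - k * h x)) / 2) / (k * (k + 1)) := by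
        field_simp
        ring
      rw [this]
      exact div_nonneg (sub_nonneg.2 hsum) (by positivity)
  · have hx' : x ∉ A := hx
    set c := κ / 2 * (harmonic A.card - 1) + (m - (∑ j ∈ A, h j) / A.card) / 2 with hc
    have hH : ∑ j ∈ A, u {j} x = A.card + ∑ y, p x y * ∑ j ∈ A, u {j} y := by
      rw [Finset.sum_congr rfl fun j hj => hu.hit_step (ne_of_mem_of_not_mem hj hx').symm]
      simp only [Finset.sum_add_distrib, Finset.sum_const, nsmul_eq_mul, mul_one, Finset.mul_sum]
      rw [Finset.sum_comm]
    have hsplit : ∑ y, p x y * (u A y - ((∑ j ∈ A, u {j} y) / A.card + c)) =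
        ∑ y, p x y * u A y - ((∑ y, p x y * ∑ j ∈ A, u {j} y) / A.card + c) := by
      conv_rhs => rw [← one_mul c, ← hp.sum_eq_one x]
      rw [Finset.sum_mul, Finset.sum_div, ← Finset.sum_add_distrib, ← Finset.sum_sub_distrib]
      exact Finset.sum_congr rfl fun y _ => by ring
    simp only [add_assoc, ← hc]
    rw [hsplit, hu.step A x hA hx', hH, add_div, div_self hn.ne']
    linarith

/-- The trapezoidal rule for the convex function `x⁻¹`: the increment of `log` from `n` to `n + 1` is
at most the mean of `1 / n` and `1 / (n + 1)`. This is `x ≤ sinh x` at `x = log ((n + 1) / n)`. -/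
theorem log_add_le_harmonic (n : ℕ) (hn : 1 ≤ n) :
    Real.log n + 1 / 2 + 1 / (2 * n) ≤ harmonic n := by
  induction n, hn using Nat.le_induction with
  | base => norm_num [harmonic]
  | succ n hn ih =>
    have hn0 : (0 : ℝ) < n := by exact_mod_cast hn
    have hlog : Real.log (n + 1) - Real.log n ≤ (1 / n + 1 / (n + 1)) / 2 := by
      have ht : (1 : ℝ) ≤ (n + 1) / n := by rw [le_div_iff₀ hn0]; linarith
      have h := Real.self_le_sinh_iff.2 (Real.log_nonneg ht)
      rw [Real.sinh_log (by positivity), Real.log_div (by positivity) hn0.ne'] at h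
      refine h.trans_eq ?_
      field_simp
      ring
    rw [harmonic_succ]
    push_cast
    have : (1 : ℝ) / (2 * n) - 1 / (2 * (n + 1)) = (1 / n + 1 / (n + 1)) / 2 - (n + 1 : ℝ)⁻¹ := by
      field_simp
      ring
    linarith

/-- Lower bound on the time to visit all of `S` from a stationary start: the average over `π` of
`IsVisitTime.matthews_bound`, with the minimum of the potential over `S` for `m`. -/
theorem IsVisitTime.log_bound (hu : IsVisitTime p u) (hp : IsIrreducibleChain p)
    (hπ0 : ∀ x, 0 ≤ π x) (hπ1 : ∑ x, π x = 1) (hrev : ∀ x y, π x * p x y = π y * p y x)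
    {κ : ℝ} (hκ0 : 0 ≤ κ) (S : Finset V) (hS : S.Nonempty)
    (hκ : ∀ i ∈ S, ∀ j ∈ S, i ≠ j → κ ≤ u {j} i + u {i} j) :
    κ * Real.log S.card / 2 ≤ ∑ x, π x * u S x := by
  have hstat : ∀ y, ∑ x, π x * p x y = π y := fun y => by
    simp only [hrev _ y, ← Finset.mul_sum, hp.sum_eq_one, mul_one]
  set h : V → ℝ := fun j => ∑ x, π x * u {j} x with hh
  obtain ⟨v, hv, hmin⟩ := S.exists_min_image h hS
  have hn : (0 : ℝ) < S.card := by exact_mod_cast hS.card_pos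
  have hbound := Finset.sum_le_sum fun x (_ : x ∈ Finset.univ) => mul_le_mul_of_nonneg_left
    (hu.matthews_bound hp (h := h) (fun i j => hu.hit_sub_hit hπ1 hstat hrev i j) S hS hκ hmin x)
    (hπ0 x)
  set c := κ / 2 * (harmonic S.card - 1) + (h v - (∑ j ∈ S, h j) / S.card) / 2 with hc
  have havg : ∑ x, π x * ((∑ j ∈ S, u {j} x) / S.card + c) = (∑ j ∈ S, h j) / S.card + c := by
    simp only [mul_add, Finset.sum_add_distrib, ← Finset.sum_mul, hπ1, one_mul, ← mul_div_assoc,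
      ← Finset.sum_div, Finset.mul_sum, hh]
    rw [Finset.sum_comm]
  simp only [add_assoc, ← hc] at hbound
  rw [havg] at hbound
  refine le_trans ?_ hbound
  -- The potentials contribute at least `κ / 2 * (1 / 2 - 1 / (2 * |S|))`: pair each state with `v`.
  have hpair : (S.card - 1) * (κ / 2) ≤ ∑ j ∈ S, h j + (S.card - 2) * h v := by
    have hterm : ∀ j ∈ S.erase v, κ / 2 ≤ h v + h j := by
      intro j hj
      have h1 := hu.half_commute_le hp hπ0 hπ1 hstat hrev v j
      have h2 := hκ v hv j (Finset.mem_of_mem_erase hj) (Finset.ne_of_mem_erase hj).symm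
      linarith
    have hsum := Finset.sum_le_sum hterm
    rw [Finset.sum_add_distrib, Finset.sum_const, Finset.sum_const, nsmul_eq_mul,
      nsmul_eq_mul] at hsum
    have hcard : ((S.erase v).card : ℝ) = S.card - 1 := by
      rw [Finset.card_erase_of_mem hv, Nat.cast_sub hS.card_pos, Nat.cast_one]
    rw [hcard] at hsum
    rw [← Finset.add_sum_erase S h hv]
    linarith
  have hv0 : 0 ≤ h v :=
    Finset.sum_nonneg fun x _ => mul_nonneg (hπ0 x) (hu.hit_nonneg hp x v)
  have hpot : κ / 2 * (1 / 2 - 1 / (2 * S.card)) ≤ ((∑ j ∈ S, h j) / S.card + h v) / 2 := by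
    rw [← sub_nonneg]
    have : ((∑ j ∈ S, h j) / S.card + h v) / 2 - κ / 2 * (1 / 2 - 1 / (2 * S.card)) =
        ((∑ j ∈ S, h j + (S.card - 2) * h v - (S.card - 1) * (κ / 2)) + 2 * h v) /
          (2 * S.card) := by
      field_simp
      ring
    rw [this]
    refine div_nonneg ?_ (by positivity)
    linarith
  have hlog := mul_le_mul_of_nonneg_left (log_add_le_harmonic S.card hS.card_pos)
    (show 0 ≤ κ / 2 by linarith)
  rw [hc]
  linarith

end Chain

/-! ### Trajectories and visiting times -/

/-- The trajectories that follow `s` up to time `n`. -/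
def pathCylinder {V : Type*} (n : ℕ) (s : ℕ → V) : Set (ℕ → V) :=
  {w | ∀ k ≤ n, w k = s k}

theorem pathCylinder_eq_preimage {V : Type*} (n : ℕ) (s : ℕ → V) :
    pathCylinder n s = Preorder.frestrictLe (π := fun _ => V) n ⁻¹'
      {Preorder.frestrictLe (π := fun _ => V) n s} := by
  ext w
  simp [pathCylinder, funext_iff, Preorder.frestrictLe_apply]

theorem measurableSet_pathCylinder {V : Type*} [Finite V] [MeasurableSpace V]
    [DiscreteMeasurableSpace V] (n : ℕ) (s : ℕ → V) : MeasurableSet (pathCylinder n s) := by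
  rw [pathCylinder_eq_preimage]
  exact (by fun_prop : Measurable (Preorder.frestrictLe (π := fun _ => V) n))
    (measurableSet_singleton _)

/-- Trajectories in a finite space have a law determined by the probabilities of finite paths. -/
theorem measure_ext_of_pathCylinder {V : Type*} [Finite V] [MeasurableSpace V]
    [DiscreteMeasurableSpace V] {μ ν : Measure (ℕ → V)} [IsFiniteMeasure μ]
    (h : ∀ n s, μ (pathCylinder n s) = ν (pathCylinder n s)) : μ = ν := by
  have hproj : IsProjectiveMeasureFamily (α := fun _ => V)
      fun I : Finset ℕ => μ.map (I.restrict (π := fun _ => V)) :=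
    fun I J hJI => by
      dsimp only
      rw [Measure.map_map (Finset.measurable_restrict₂ (X := fun _ => V) hJI) (by fun_prop),
        Finset.restrict₂_comp_restrict]
  refine IsProjectiveLimit.unique (P := fun I : Finset ℕ => μ.map (I.restrict (π := fun _ => V)))
    (fun I => rfl) ((isProjectiveLimit_nat_iff hproj ν).2 fun n => ?_)
  refine Measure.ext_of_singleton fun t => ?_
  rcases isEmpty_or_nonempty V with hV | hV
  · exact (hV.false (t ⟨0, by simp⟩)).elim
  · let s : ℕ → V := fun k => if hk : k ∈ Finset.Iic n then t ⟨k, hk⟩ else hV.some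
    have hs : Preorder.frestrictLe (π := fun _ => V) n s = t := by
      ext k
      simp only [Preorder.frestrictLe_apply, s]
      rw [dif_pos k.2]
    have := h n s
    rw [pathCylinder_eq_preimage, hs] at this
    rw [Measure.map_apply (by fun_prop) (measurableSet_singleton _),
      Measure.map_apply (by fun_prop) (measurableSet_singleton _)]
    exact this.symm

/-- The trajectory that starts at `x` and then follows `w`. -/
def consPath {V : Type*} (x : V) (w : ℕ → V) : ℕ → V
  | 0 => x
  | n + 1 => w n

theorem measurable_consPath {V : Type*} [MeasurableSpace V] (x : V) :
    Measurable (consPath x) :=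
  measurable_pi_lambda _ fun n => by
    cases n with
    | zero => exact measurable_const
    | succ n => exact measurable_pi_apply n

theorem consPath_preimage_pathCylinder_zero {V : Type*} (x : V) (s : ℕ → V) :
    consPath x ⁻¹' pathCylinder 0 s = {_w | x = s 0} := by
  ext w
  simp [pathCylinder, consPath]

theorem consPath_preimage_pathCylinder_succ {V : Type*} (x : V) (n : ℕ) (s : ℕ → V) :
    consPath x ⁻¹' pathCylinder (n + 1) s =
      {_w | x = s 0} ∩ pathCylinder n fun k => s (k + 1) := by
  ext w
  simp only [pathCylinder, Set.mem_preimage, Set.mem_ofPred_eq, Set.mem_inter_iff]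
  refine ⟨fun h => ⟨h 0 (by omega), fun k hk => h (k + 1) (by omega)⟩, fun h k hk => ?_⟩
  cases k with
  | zero => exact h.1
  | succ k => exact h.2 k (by omega)

theorem hitTime_eq_zero {V : Type*} {j : V} {w : ℕ → V} (h : w 0 = j) : hitTime j w = 0 :=
  le_antisymm ((iInf₂_le 0 h).trans_eq (by simp)) zero_le

theorem hitTime_consPath_of_ne {V : Type*} {x j : V} (h : x ≠ j) (w : ℕ → V) :
    hitTime j (consPath x w) = 1 + hitTime j w := by
  simp only [hitTime]
  rw [← inf_iInf_nat_succ, ENNReal.add_iInf]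
  simp only [consPath, h, iInf_false, top_inf_eq, ENNReal.add_iInf]
  push_cast
  simp only [add_comm]

theorem measurable_hitTime {V : Type*} [MeasurableSpace V] [DiscreteMeasurableSpace V] (j : V) :
    Measurable (hitTime j) :=
  Measurable.iInf fun n => (Measurable.of_discrete
    (f := fun v : V => ⨅ _ : v = j, (n : ℝ≥0∞))).comp (measurable_pi_apply n)

/-- The first time by which the trajectory `w` has visited all states of `A`. -/
noncomputable def visitTime {V : Type*} (A : Finset V) (w : ℕ → V) : ℝ≥0∞ :=
  A.sup fun j => hitTime j w

theorem measurable_visitTime {V : Type*} [MeasurableSpace V] [DiscreteMeasurableSpace V]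
    (A : Finset V) : Measurable (visitTime A) := by
  have h : visitTime A = fun w => ⨆ j ∈ (A : Set V), hitTime j w := by
    ext w
    simp [visitTime, Finset.sup_eq_iSup]
  rw [h]
  exact Measurable.biSup _ A.countable_toSet fun j _ => measurable_hitTime j

theorem visitTime_consPath_of_notMem {V : Type*} {A : Finset V} (hA : A.Nonempty) {x : V}
    (hx : x ∉ A) (w : ℕ → V) : visitTime A (consPath x w) = 1 + visitTime A w := by
  have h := Finset.apply_sup_eq_sup_comp_of_nonempty (f := fun j => hitTime j w)
    (g := fun t : ℝ≥0∞ => 1 + t) (fun a b hab => by dsimp only; gcongr) hA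
  simp only [visitTime]
  rw [h]
  exact Finset.sup_congr rfl fun j hj =>
    hitTime_consPath_of_ne (ne_of_mem_of_not_mem hj hx).symm w

theorem visitTime_consPath_of_mem {V : Type*} [DecidableEq V] {A : Finset V} {x : V}
    (hx : x ∈ A) (w : ℕ → V) :
    visitTime A (consPath x w) = visitTime (A.erase x) (consPath x w) := by
  conv_lhs => rw [← Finset.insert_erase hx]
  rw [visitTime, Finset.sup_insert, hitTime_eq_zero (show consPath x w 0 = x from rfl)]
  exact bot_sup_eq _

theorem hitTime_le_covTime {V : Type*} (j : V) (w : ℕ → V) : hitTime j w ≤ covTime w := by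
  refine le_iInf₂ fun n hn => ?_
  obtain ⟨k, hk, hw⟩ := hn j
  exact (iInf₂_le k hw).trans (by exact_mod_cast hk)

theorem visitTime_le_covTime {V : Type*} (A : Finset V) (w : ℕ → V) : visitTime A w ≤ covTime w :=
  Finset.sup_le fun j _ => hitTime_le_covTime j w

/-! ### The Markov property of the walk at time one -/

section Walk

universe u v

variable {α : Type u} {β : Type v} (G : Graph α β) [Finite E(G)]

instance (i : V(G)) : IsProbabilityMeasure (walkLaw G i) := by
  unfold walkLaw
  infer_instance

theorem walkLaw_map_zero (i : V(G)) :
    (walkLaw G i).map (Preorder.frestrictLe (π := fun _ => V(G)) 0) =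
      Measure.dirac fun _ => i := by
  rw [walkLaw, Kernel.trajMeasure, Measure.map_comp _ _ (by fun_prop), Kernel.traj_map_frestrictLe,
    Kernel.partialTraj_self, Measure.id_comp, Measure.map_dirac' (by fun_prop)]
  rfl

theorem walkLaw_map_succ (i : V(G)) (n : ℕ) :
    (walkLaw G i).map (fun w => (Preorder.frestrictLe (π := fun _ => V(G)) n w, w (n + 1))) =
      ((walkLaw G i).map (Preorder.frestrictLe (π := fun _ => V(G)) n)) ⊗ₘ
        ((stepKernel G).comap (fun h => h ⟨n, by simp⟩) (by fun_prop)) :=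
  Kernel.map_frestrictLe_trajMeasure_compProd_eq_map_trajMeasure.symm

/-- The expected time in which the walk from `x` has visited all vertices of `A`. -/
noncomputable def expVisit (A : Finset V(G)) (x : V(G)) : ℝ≥0∞ :=
  ∫⁻ w, visitTime A w ∂walkLaw G x

theorem expVisit_le_C (A : Finset V(G)) (x : V(G)) : expVisit G A x ≤ C G x :=
  lintegral_mono fun w => visitTime_le_covTime A w

theorem expVisit_singleton (i j : V(G)) : expVisit G {j} i = H G i j := by
  simp [expVisit, visitTime, H]

theorem sum_step [Fintype V(G)] (x : V(G)) : ∑ y, step G x y = 1 := by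
  rw [← tsum_fintype (L := .unconditional _), PMF.tsum_coe]

variable [Finite V(G)]

theorem walkLaw_pathCylinder_zero (i : V(G)) (s : ℕ → V(G)) :
    walkLaw G i (pathCylinder 0 s) = Set.indicator {i} 1 (s 0) := by
  classical
  rw [pathCylinder_eq_preimage, ← Measure.map_apply (by fun_prop) (measurableSet_singleton _),
    walkLaw_map_zero, Measure.dirac_apply' _ (measurableSet_singleton _)]
  simp only [Set.indicator_apply, Set.mem_singleton_iff, Pi.one_apply]
  congr 1
  simp [funext_iff, Preorder.frestrictLe_apply, eq_comm]

theorem walkLaw_pathCylinder_succ (i : V(G)) (n : ℕ) (s : ℕ → V(G)) :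
    walkLaw G i (pathCylinder (n + 1) s) =
      walkLaw G i (pathCylinder n s) * step G (s n) (s (n + 1)) := by
  have h : pathCylinder (n + 1) s =
      (fun w => (Preorder.frestrictLe (π := fun _ => V(G)) n w, w (n + 1))) ⁻¹'
        ({Preorder.frestrictLe (π := fun _ => V(G)) n s} ×ˢ {s (n + 1)}) := by
    ext w
    simp only [pathCylinder, Set.mem_ofPred_eq, Set.mem_preimage, Set.mem_prod,
      Set.mem_singleton_iff, funext_iff, Preorder.frestrictLe_apply, Subtype.forall,
      Finset.mem_Iic]
    refine ⟨fun hw => ⟨fun k hk => hw k (by omega), hw _ le_rfl⟩, fun hw k hk => ?_⟩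
    rcases hk.eq_or_lt with rfl | hk
    · exact hw.2
    · exact hw.1 k (by omega)
  rw [h, ← Measure.map_apply (by fun_prop)
    ((measurableSet_singleton _).prod (measurableSet_singleton _)), walkLaw_map_succ,
    Measure.compProd_apply_prod (measurableSet_singleton _) (measurableSet_singleton _),
    lintegral_singleton, pathCylinder_eq_preimage,
    ← Measure.map_apply (by fun_prop) (measurableSet_singleton _), mul_comm]
  congr 1
  exact PMF.toMeasure_apply_singleton _ _ (measurableSet_singleton _)

/-- Markov property at time one: after its first step the walk is a fresh walk. -/
theorem walkLaw_eq_sum [Fintype V(G)] (x : V(G)) :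
    walkLaw G x = ∑ y, step G x y • (walkLaw G y).map (consPath x) := by
  classical
  refine measure_ext_of_pathCylinder fun n s => ?_
  simp only [Measure.finsetSum_apply, Measure.smul_apply, smul_eq_mul,
    Measure.map_apply (measurable_consPath x) (measurableSet_pathCylinder n s)]
  induction n with
  | zero =>
    rw [walkLaw_pathCylinder_zero]
    simp only [consPath_preimage_pathCylinder_zero]
    by_cases h : x = s 0
    · simp [h.symm, sum_step]
    · simp [h, Ne.symm h]
  | succ n ih =>
    rw [walkLaw_pathCylinder_succ, ih, Finset.sum_mul]
    simp only [consPath_preimage_pathCylinder_succ]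
    by_cases h : x = s 0
    · simp only [h, Set.ofPred_true, Set.univ_inter]
      cases n with
      | zero =>
        simp only [consPath_preimage_pathCylinder_zero, Set.ofPred_true, walkLaw_pathCylinder_zero,
          measure_univ, mul_one, ← h]
        rw [← Finset.sum_mul, sum_step, one_mul]
        simp [Set.indicator_apply, eq_comm]
      | succ n =>
        simp only [consPath_preimage_pathCylinder_succ, Set.ofPred_true, Set.univ_inter,
          walkLaw_pathCylinder_succ, mul_assoc]
    · cases n with
      | zero => simp [h, consPath_preimage_pathCylinder_zero]
      | succ n => simp [h, consPath_preimage_pathCylinder_succ]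

theorem lintegral_walkLaw [Fintype V(G)] (x : V(G)) {f : (ℕ → V(G)) → ℝ≥0∞} (hf : Measurable f) :
    ∫⁻ w, f w ∂walkLaw G x = ∑ y, step G x y * ∫⁻ w, f (consPath x w) ∂walkLaw G y := by
  conv_lhs => rw [walkLaw_eq_sum G x]
  rw [lintegral_finsetSum_measure]
  simp only [lintegral_smul_measure, lintegral_map hf (measurable_consPath x), smul_eq_mul]

/-- First-step analysis. Finiteness is needed because infinite visiting times become `0` in `ℝ`. -/
theorem isVisitTime_expVisit [Fintype V(G)] [DecidableEq V(G)] (hfin : ∀ x, C G x ≠ ∞) :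
    IsVisitTime (fun x y => (step G x y).toReal) fun A x => (expVisit G A x).toReal where
  empty x := by simp [expVisit, visitTime]
  step A x hA hx := by
    have h : expVisit G A x = 1 + ∑ y, step G x y * expVisit G A y := by
      rw [expVisit, lintegral_walkLaw G x (measurable_visitTime A)]
      simp only [visitTime_consPath_of_notMem hA hx, lintegral_add_left measurable_const,
        lintegral_const, measure_univ, mul_one, mul_add, Finset.sum_add_distrib, sum_step]
      rfl
    have hne : ∀ y, step G x y * expVisit G A y ≠ ∞ := fun y =>
      ENNReal.mul_ne_top ((step G x).apply_ne_top y)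
        (ne_top_of_le_ne_top (hfin y) (expVisit_le_C G A y))
    rw [h, ENNReal.toReal_add ENNReal.one_ne_top (ENNReal.sum_ne_top.2 fun y _ => hne y),
      ENNReal.toReal_sum fun y _ => hne y]
    simp only [ENNReal.toReal_mul, ENNReal.toReal_one]
  erase A x hx := by
    congr 1
    rw [expVisit, expVisit, lintegral_walkLaw G x (measurable_visitTime A),
      lintegral_walkLaw G x (measurable_visitTime _)]
    simp only [visitTime_consPath_of_mem hx]

end Walk

/-! ### Reversibility of the walk on a graph -/

section Reversible

universe u v

variable {α : Type u} {β : Type v} (G : Graph α β)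

/-- The number of edges between `x` and `y`; a loop at `x` counts once. -/
noncomputable def numLinks (x y : V(G)) : ℕ :=
  {e | G.IsLink e (x : α) (y : α)}.ncard

theorem numLinks_comm (x y : V(G)) : numLinks G x y = numLinks G y x := by
  simp only [numLinks, G.isLink_comm]

theorem Connected.incidenceSet_nonempty {G : Graph α β} (hG : Connected G) [Nontrivial V(G)]
    (x : V(G)) : (G.incidenceSet (x : α)).Nonempty := by
  obtain ⟨y, hy⟩ := exists_ne x
  rcases (hG.2 x x.2 y y.2).cases_head with h | ⟨z, ⟨e, he⟩, -⟩
  · exact (hy (Subtype.ext h.symm)).elim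
  · exact ⟨e, z, he⟩

variable [Finite E(G)]

theorem numLinks_pos_of_adj {x y : V(G)} (h : G.Adj (x : α) (y : α)) : 0 < numLinks G x y := by
  obtain ⟨e, he⟩ := h
  exact (Set.ncard_pos ((Set.toFinite E(G)).subset fun _ h => Graph.IsLink.edge_mem h)).2 ⟨e, he⟩

/-- Transition probabilities: an edge is chosen among those incident with `x`, each loop being
chosen as one edge. -/
theorem step_apply {x : V(G)} (hx : (G.incidenceSet (x : α)).Nonempty) (y : V(G)) :
    (step G x y).toReal = numLinks G x y / (G.incidenceSet (x : α)).ncard := by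
  classical
  set s := (incidenceSet_finite G (x : α)).toFinset with hs
  have hsum : step G x y =
      ∑ e ∈ s, if G.IsLink e (x : α) (y : α) then ((s.card : ℕ) : ℝ≥0∞)⁻¹ else 0 := by
    rw [step, dif_pos hx, PMF.map_apply, tsum_eq_sum (s := s)]
    · refine Finset.sum_congr rfl fun e he => ?_
      have hinc : G.Inc e (x : α) := by simpa [hs] using he
      rw [PMF.uniformOfFinset_apply_of_mem _ he, dif_pos hinc]
      have hiff : G.IsLink e (x : α) (y : α) ↔ y = ⟨hinc.other, hinc.isLink_other.right_mem⟩ := by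
        rw [hinc.isLink_other.isLink_iff_eq, Subtype.ext_iff]
      by_cases h : G.IsLink e (x : α) (y : α)
      · rw [if_pos h, if_pos (hiff.1 h)]
      · rw [if_neg h, if_neg (hiff.not.1 h)]
    · intro e he
      rw [PMF.uniformOfFinset_apply_of_notMem _ he, ite_self]
  have hlinks : (numLinks G x y : ℝ≥0∞) =
      ((s.filter fun e => G.IsLink e (x : α) (y : α)).card : ℕ) := by
    rw [numLinks, ← Set.ncard_coe_finset]
    congr 2
    ext e
    simpa [hs] using fun h : G.IsLink e (x : α) (y : α) => h.inc_left
  rw [hsum, ← Finset.sum_filter, Finset.sum_const, nsmul_eq_mul, ← hlinks,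
    Set.ncard_eq_toFinset_card _ (incidenceSet_finite G (x : α)), ← hs, ← div_eq_mul_inv,
    ENNReal.toReal_div, ENNReal.toReal_natCast, ENNReal.toReal_natCast]

theorem step_reversible {x y : V(G)} (hx : (G.incidenceSet (x : α)).Nonempty)
    (hy : (G.incidenceSet (y : α)).Nonempty) :
    (G.incidenceSet (x : α)).ncard * (step G x y).toReal =
      (G.incidenceSet (y : α)).ncard * (step G y x).toReal := by
  have hx0 : ((G.incidenceSet (x : α)).ncard : ℝ) ≠ 0 := by
    exact_mod_cast ((Set.ncard_pos (incidenceSet_finite G _)).2 hx).ne'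
  have hy0 : ((G.incidenceSet (y : α)).ncard : ℝ) ≠ 0 := by
    exact_mod_cast ((Set.ncard_pos (incidenceSet_finite G _)).2 hy).ne'
  rw [step_apply G hx, step_apply G hy, mul_div_cancel₀ _ hx0, mul_div_cancel₀ _ hy0,
    numLinks_comm]

variable {G}

theorem Connected.isIrreducibleChain (hG : Connected G) [Fintype V(G)] [Nontrivial V(G)] :
    IsIrreducibleChain fun x y : V(G) => (step G x y).toReal where
  nonneg _ _ := ENNReal.toReal_nonneg
  sum_eq_one x := by
    rw [← ENNReal.toReal_sum fun y _ => (step G x).apply_ne_top y, sum_step, ENNReal.toReal_one]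
  irreducible x y := by
    have key : ∀ b : α, Relation.ReflTransGen G.Adj x b → ∀ hb : b ∈ V(G),
        Relation.ReflTransGen (fun a b : V(G) => 0 < (step G a b).toReal) x ⟨b, hb⟩ := by
      intro b hxb
      induction hxb with
      | refl => exact fun _ => .refl
      | @tail b c _ hbc ih =>
        intro hc
        refine (ih hbc.left_mem).tail ?_
        have hb := hG.incidenceSet_nonempty ⟨b, hbc.left_mem⟩
        rw [step_apply G hb]
        have h1 := numLinks_pos_of_adj G (x := ⟨b, hbc.left_mem⟩) (y := ⟨c, hc⟩) hbc
        have h2 := (Set.ncard_pos (incidenceSet_finite G _)).2 hb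
        positivity
    exact key y (hG.2 x x.2 y y.2) y.2

/-- A stationary distribution is a multiple of the degree, because its density with respect to the
degree is harmonic. Hence it is positive and satisfies detailed balance. -/
theorem IsStationary.pos_and_reversible {π : PMF V(G)} (hπ : IsStationary G π) (hG : Connected G)
    [Fintype V(G)] [Nontrivial V(G)] :
    (∀ x, 0 < (π x).toReal) ∧
      ∀ x y, (π x).toReal * (step G x y).toReal = (π y).toReal * (step G y x).toReal := by
  have hne := hG.incidenceSet_nonempty
  have hd : ∀ x : V(G), (0 : ℝ) < (G.incidenceSet (x : α)).ncard := fun x => by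
    exact_mod_cast (Set.ncard_pos (incidenceSet_finite G _)).2 (hne x)
  have hstat : ∀ y, ∑ x, (π x).toReal * (step G x y).toReal = (π y).toReal := by
    intro y
    conv_rhs => rw [← show π.bind (step G) = π from hπ, PMF.bind_apply, tsum_fintype]
    rw [ENNReal.toReal_sum fun x _ =>
      ENNReal.mul_ne_top (π.apply_ne_top x) ((step G x).apply_ne_top y)]
    simp only [ENNReal.toReal_mul]
  obtain ⟨x₀⟩ : Nonempty V(G) := inferInstance
  set r : V(G) → ℝ := fun x => (π x).toReal / (G.incidenceSet (x : α)).ncard with hr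
  have hπr : ∀ x, (π x).toReal = r x * (G.incidenceSet (x : α)).ncard := fun x => by
    rw [hr, div_mul_cancel₀ _ (hd x).ne']
  have hconst : ∀ x, r x = r x₀ := by
    refine fun x => hG.isIrreducibleChain.eq_of_harmonic (fun y => ?_) x x₀
    rw [hr, eq_div_iff (hd y).ne', ← hstat y, Finset.sum_mul]
    refine Finset.sum_congr rfl fun x _ => ?_
    rw [hπr x]
    simp only
    linear_combination -(r x) * step_reversible G (hne x) (hne y)
  have hr0 : 0 < r x₀ := by
    refine lt_of_le_of_ne (div_nonneg ENNReal.toReal_nonneg (hd x₀).le) fun h => ?_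
    obtain ⟨z, hz⟩ := π.support_nonempty
    refine (ENNReal.toReal_pos ((π.mem_support_iff z).1 hz) (π.apply_ne_top z)).ne' ?_
    rw [hπr z, hconst z, ← h, zero_mul]
  refine ⟨fun x => ?_, fun x y => ?_⟩
  · rw [hπr, hconst]
    exact mul_pos hr0 (hd x)
  · rw [hπr x, hπr y, hconst x, hconst y]
    linear_combination r x₀ * step_reversible G (hne x) (hne y)

end Reversible

end CoverTime

theorem theorem1p4 {α : Type*} {β : Type*} (G : Graph α β) [Finite V(G)] [Finite E(G)]
    (hG : CoverTime.Connected G) (π : PMF V(G)) (hπ : CoverTime.IsStationary G π) :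
    CoverTime.M G / 2 ≤ CoverTime.Cstart G π := by
  classical
  open CoverTime in
  have := Fintype.ofFinite V(G)
  rw [ENNReal.div_le_iff_le_mul (by simp) (by simp), M]
  refine iSup_le fun S => ?_
  rw [commuteMin]
  split_ifs with hS
  swap
  · simp
  have : Nontrivial V(G) := by
    obtain ⟨a, -, b, -, hab⟩ := Finset.one_lt_card.1 (show 1 < S.card by omega)
    exact ⟨a, b, hab⟩
  obtain ⟨hpos, hrev⟩ := hπ.pos_and_reversible hG
  by_cases hfin : ∀ x, C G x ≠ ∞
  swap
  · obtain ⟨x, hx⟩ := not_forall.1 hfin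
    have htop : Cstart G π = ∞ := by
      refine top_unique (le_trans (le_of_eq ?_) (ENNReal.le_tsum x))
      rw [not_ne_iff.1 hx, ENNReal.mul_top (ENNReal.toReal_pos_iff.1 (hpos x)).1.ne']
    simp [htop]
  have hH : ∀ i j, H G i j ≠ ∞ := fun i j =>
    expVisit_singleton G i j ▸ ne_top_of_le_ne_top (hfin i) (expVisit_le_C G {j} i)
  set K := ⨅ (i ∈ S) (j ∈ S) (_ : i ≠ j), commute G i j with hK
  have hKle : ∀ i ∈ S, ∀ j ∈ S, i ≠ j → K ≤ commute G i j := fun i hi j hj hij =>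
    iInf₂_le_of_le i hi (iInf₂_le_of_le j hj (iInf_le _ hij))
  have hKtop : K ≠ ∞ := by
    obtain ⟨a, ha, b, hb, hab⟩ := Finset.one_lt_card.1 (show 1 < S.card by omega)
    exact ne_top_of_le_ne_top (ENNReal.add_ne_top.2 ⟨hH a b, hH b a⟩) (hKle a ha b hb hab)
  have hπ1 : ∑ x, (π x).toReal = 1 := by
    rw [← ENNReal.toReal_sum fun x _ => π.apply_ne_top x,
      ← tsum_fintype (L := .unconditional _), PMF.tsum_coe, ENNReal.toReal_one]
  have hbound := (isVisitTime_expVisit G hfin).log_bound hG.isIrreducibleChain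
    (fun x => (hpos x).le) hπ1 hrev (κ := K.toReal) ENNReal.toReal_nonneg S
    (Finset.card_pos.1 (by omega)) fun i hi j hj hij => by
      rw [expVisit_singleton, expVisit_singleton, ← ENNReal.toReal_add (hH i j) (hH j i)]
      exact ENNReal.toReal_mono (ENNReal.add_ne_top.2 ⟨hH i j, hH j i⟩) (hKle i hi j hj hij)
  have hexp : ∑ x, (π x).toReal * (expVisit G S x).toReal ≤ (Cstart G π).toReal := by
    have hne : ∀ x, π x * C G x ≠ ∞ := fun x => ENNReal.mul_ne_top (π.apply_ne_top x) (hfin x)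
    rw [Cstart, tsum_fintype, ENNReal.toReal_sum fun x _ => hne x]
    refine Finset.sum_le_sum fun x _ => ?_
    rw [← ENNReal.toReal_mul]
    exact ENNReal.toReal_mono (hne x) (by gcongr; exact expVisit_le_C G S x)
  have hCtop : Cstart G π ≠ ∞ := by
    rw [Cstart, tsum_fintype]
    exact ENNReal.sum_ne_top.2 fun x _ => ENNReal.mul_ne_top (π.apply_ne_top x) (hfin x)
  rw [← ENNReal.toReal_le_toReal (ENNReal.mul_ne_top hKtop ENNReal.ofReal_ne_top)
    (ENNReal.mul_ne_top hCtop (by simp)), ENNReal.toReal_mul, ENNReal.toReal_mul,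
    ENNReal.toReal_ofReal (Real.log_natCast_nonneg _), ENNReal.toReal_ofNat]
  linarith
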